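/- Let $X$ be a reflexive real Banach space with dual $X^*$, and let $A:X\rightrightarrows X^*$ be a maximal monotone operator whose domain $D(A)=\{x\in X: Ax\neq\emptyset\}$ satisfies $\operatorname{int}(D(A))\neq\emptyset$. Let $D\subset D(A)$ be dense in $D(A)$, and let $\tilde A$ be a selection of $A$, i.e. a single-valued map with $\tilde A(y)\in Ay$ for all $y\in D(A)$. For $x,v\in X$ put $$w\text{-}\mathop{\mathrm{Limsup}}_{\substack{w\to v,\ t\downarrow 0\\ x+tw\in D}}\tilde A(x+tw):=\Big\{x^*\in X^* : \exists\, w_n\to v,\ t_n\downarrow 0 \text{ with } t_n>0,\ x+t_nw_n\in D \text{ for all } n,\ \tilde A(x+t_nw_n)\rightharpoonup x^*\Big\},$$ $$w\text{-}\mathop{\mathrm{Limsup}}_{y\overset{D}{\to}x}\tilde A y:=\Big\{x^*\in X^* : \exists\, y_n\to x \text{ with } y_n\in D \text{ for all } n,\ \tilde A(y_n)\rightharpoonup x^*\Big\},$$ where $\rightharpoonup$ is weak convergence in $X^*$, and let $N(x;\overline{D(A)}):=\{x^*\in X^*: \langle x^*,y-x\rangle\le 0\ \ \forall y\in\overline{D(A)}\}$.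 Then, for every $x\in X$, $$Ax=\overline{\operatorname{co}}\Big\{\bigcup_{v\in\operatorname{int}(D(A))-x} w\text{-}\mathop{\mathrm{Limsup}}_{\substack{w\to v,\ t\downarrow 0\\ x+tw\in D}}\tilde A(x+tw)\Big\}+N(x;\overline{D(A)})$$ $$\phantom{Ax}=\overline{\operatorname{co}}\Big\{w\text{-}\mathop{\mathrm{Limsup}}_{y\overset{D}{\to}x}\tilde A y\Big\}+N(x;\overline{D(A)}),$$ where $\overline{\operatorname{co}}$ is the closed convex hull in $X^*$ ($\overline{\operatorname{co}}\,\emptyset=\emptyset$), and a sum of sets with an empty summand is empty. -/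

import Mathlib

open scoped Topology Pointwise

namespace MonotoneOperator

/-- A real normed space is reflexive if the canonical embedding into its bidual is onto. -/
def IsReflexiveSpace (X : Type*) [NormedAddCommGroup X] [NormedSpace ℝ X] : Prop :=
  Function.Surjective (NormedSpace.inclusionInDoubleDual ℝ X)

variable {X : Type*} [NormedAddCommGroup X] [NormedSpace ℝ X]

/-- The domain `D(A) = {x | A x ≠ ∅}` of a set-valued operator. -/
def dom (A : X → Set (StrongDual ℝ X)) : Set X :=
  {x | (A x).Nonempty}

/-- `⟨x* - y*, x - y⟩ ≥ 0` for all `(x, x*)`, `(y, y*)` in the graph of `A`. -/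
def IsMonotone (A : X → Set (StrongDual ℝ X)) : Prop :=
  ∀ x y : X, ∀ f ∈ A x, ∀ g ∈ A y, 0 ≤ (f - g) (x - y)

/-- `A` is monotone and has no proper monotone extension, in the sense of graph inclusion. -/
def IsMaximalMonotone (A : X → Set (StrongDual ℝ X)) : Prop :=
  IsMonotone A ∧
    ∀ B : X → Set (StrongDual ℝ X), IsMonotone B → (∀ x, A x ⊆ B x) → B = A

/-- `s` is a (single-valued) selection of `A`; its values outside `dom A` are irrelevant. -/
def IsSelection (s : X → StrongDual ℝ X) (A : X → Set (StrongDual ℝ X)) : Prop :=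
  ∀ x ∈ dom A, s x ∈ A x

/-- The normal cone `N(x; S) = {f | sup_{y ∈ S} ⟨f, y - x⟩ ≤ 0}`. -/
def normalCone (x : X) (S : Set X) : Set (StrongDual ℝ X) :=
  {f | ∀ y ∈ S, f (y - x) ≤ 0}

/-- Weak convergence `u n ⇀ f` in the dual space `X*`, i.e. for the topology `σ(X*, X**)`. -/
def WeaklyTendsto (u : ℕ → StrongDual ℝ X) (f : StrongDual ℝ X) : Prop :=
  Filter.Tendsto (fun n => toWeakSpace ℝ (StrongDual ℝ X) (u n)) Filter.atTop
    (𝓝 (toWeakSpace ℝ (StrongDual ℝ X) f))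

/-- The set of weak limits of `s (x + t n • w n)` over sequences `w n → v`, `t n ↓ 0` with
`x + t n • w n ∈ D` for all `n`. -/
def weakLimsupDir (s : X → StrongDual ℝ X) (D : Set X) (x v : X) : Set (StrongDual ℝ X) :=
  {f | ∃ (w : ℕ → X) (t : ℕ → ℝ),
    Filter.Tendsto w Filter.atTop (𝓝 v) ∧
    (∀ n, 0 < t n) ∧ Filter.Tendsto t Filter.atTop (𝓝 0) ∧
    (∀ n, x + t n • w n ∈ D) ∧
    WeaklyTendsto (fun n => s (x + t n • w n)) f}

/-- The set of weak limits of `s (y n)` over sequences `y n → x` with `y n ∈ D` for all `n`. -/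
def weakLimsup (s : X → StrongDual ℝ X) (D : Set X) (x : X) : Set (StrongDual ℝ X) :=
  {f | ∃ y : ℕ → X,
    Filter.Tendsto y Filter.atTop (𝓝 x) ∧ (∀ n, y n ∈ D) ∧
    WeaklyTendsto (fun n => s (y n)) f}

end MonotoneOperator

/-!
The inclusion of the right-hand sides in `A x` is soft: the graph of a maximal monotone operator is
closed for norm × weak sequential limits, its values are closed and convex, and adding a normal
vector to the closure of the domain to an element of `A x` preserves monotonicity. It remains to
represent each `f ∈ A x` by directional limits.

Suppose `f` is not in `K + N`, where `K` is the closed convex hull of the directional limits and `N`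
the normal cone. Fix `v₀` with `x + v₀` interior to the domain. There is a bound
`k v₀ + ρ * ‖k‖ ≤ C` for all `k ∈ A x`, while `n v₀ ≤ 0` for `n ∈ N`. Hence, although `K` may be
unbounded, `K + N` is closed (`isClosed_add_normalCone`), and reflexivity provides a direction `v`
strictly separating `f` from `K + N`. As `N` is a cone, `v` lies in its polar, so that `v + ε • v₀`
is, up to a positive factor, a direction into the interior of the domain
(`exists_pos_add_smul_mem_interior_dom`); the upper bound for `k v₀` on `K` shows that this
direction still separates when `ε` is small. But along such a direction the selection stays bounded,
and monotonicity yields a weak limit `k ∈ K` that dominates `f` there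
(`exists_mem_weakLimsupDir_le`), a contradiction.

All facts on the domain come from the notion `HasAffineMinorants A x ρ M K`, a uniform lower bound
for `g (y - x)` along the graph. It gives `ρ * ‖g‖ ≤ g (y - x) + M * ‖y - x‖ + K` on the graph, which
contains local boundedness, and by the Hahn–Banach theorem in `X × ℝ` it forces `x` into the domain.
Baire's theorem gives bounded values on some ball, and monotonicity spreads affine minorants from
such a ball to half-open segments ending in the domain. Hence the interior of the domain is convex
and dense in the domain. Weak limits are extracted by the sequential compactness of bounded
sequences in the dual of a reflexive space (`exists_subseq_weaklyTendsto`).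
-/

namespace MonotoneOperator

open Filter Set

variable {X : Type*} [NormedAddCommGroup X] [NormedSpace ℝ X]

/-! ### Weak sequential compactness in the dual of a reflexive space -/

theorem weaklyTendsto_iff_forall_dual {u : ℕ → StrongDual ℝ X} {f : StrongDual ℝ X} :
    WeaklyTendsto u f ↔
      ∀ Φ : StrongDual ℝ (StrongDual ℝ X), Tendsto (fun n => Φ (u n)) atTop (𝓝 (Φ f)) :=
  WeakBilin.tendsto_iff_forall_eval_tendsto (topDualPairing ℝ (StrongDual ℝ X)).flip
    (fun a b hab => by
      by_contra hne
      obtain ⟨Φ, hΦ⟩ := SeparatingDual.exists_separating_of_ne (R := ℝ) hne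
      exact hΦ (LinearMap.congr_fun hab Φ))

theorem weaklyTendsto_iff_forall_apply (hX : IsReflexiveSpace X)
    {u : ℕ → StrongDual ℝ X} {f : StrongDual ℝ X} :
    WeaklyTendsto u f ↔ ∀ y, Tendsto (fun n => u n y) atTop (𝓝 (f y)) := by
  rw [weaklyTendsto_iff_forall_dual]
  refine ⟨fun h y => h (NormedSpace.inclusionInDoubleDual ℝ X y), fun h Φ => ?_⟩
  obtain ⟨y, rfl⟩ := hX Φ
  exact h y

theorem WeaklyTendsto.mem_of_convex_of_isClosed {u : ℕ → StrongDual ℝ X} {f : StrongDual ℝ X}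
    (h : WeaklyTendsto u f) {S : Set (StrongDual ℝ X)} (hconv : Convex ℝ S) (hcl : IsClosed S)
    (hu : ∀ n, u n ∈ S) : f ∈ S := by
  by_contra hf
  obtain ⟨Φ, c, hΦ, hc⟩ := geometric_hahn_banach_closed_point hconv hcl hf
  exact hc.not_ge (le_of_tendsto' (weaklyTendsto_iff_forall_dual.1 h Φ) fun n => (hΦ _ (hu n)).le)

/-- Countably many vectors separate the points of the closed span of a sequence of functionals:
choose, for each member of a countable dense subset, a vector almost norming it. -/
theorem exists_seq_separating (u : ℕ → StrongDual ℝ X) :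
    ∃ y : ℕ → X, ∀ h ∈ closure (Submodule.span ℝ (range u) : Set (StrongDual ℝ X)),
      (∀ j, h (y j) = 0) → h = 0 := by
  have hsep : TopologicalSpace.IsSeparable
      (closure (Submodule.span ℝ (range u) : Set (StrongDual ℝ X))) :=
    ((countable_range u).isSeparable.span (R := ℝ)).closure
  obtain ⟨c, hc, hcd⟩ := hsep
  obtain ⟨g, hg⟩ := (hc.insert 0).exists_eq_range (insert_nonempty 0 c)
  have hy : ∀ j, ∃ y : X, ‖y‖ ≤ 1 ∧ ‖g j‖ ≤ 2 * g j y := by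
    intro j
    by_cases h0 : g j = 0
    · exact ⟨0, by simp [h0]⟩
    have hpos : 0 < ‖g j‖ := norm_pos_iff.2 h0
    obtain ⟨y, hy1, hy2⟩ := ContinuousLinearMap.exists_lt_apply_of_lt_opNorm (g j)
      (half_lt_self hpos)
    rcases le_total 0 (g j y) with h | h
    · exact ⟨y, hy1.le, by rw [Real.norm_of_nonneg h] at hy2; linarith⟩
    · refine ⟨-y, by simpa using hy1.le, ?_⟩
      rw [Real.norm_of_nonpos h] at hy2
      rw [map_neg]; linarith
  choose y hy1 hy2 using hy
  refine ⟨y, fun h hh h0 => ?_⟩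
  by_contra hne
  have hpos : 0 < ‖h‖ := norm_pos_iff.2 hne
  obtain ⟨g', hg', hd⟩ := Metric.mem_closure_iff.1 (hcd hh) (‖h‖ / 4) (by positivity)
  obtain ⟨j, rfl⟩ : g' ∈ range g := hg ▸ mem_insert_of_mem _ hg'
  rw [dist_eq_norm] at hd
  have h1 : g j (y j) ≤ ‖h - g j‖ := by
    have := (g j - h).le_opNorm (y j)
    have h2 := le_abs_self ((g j - h) (y j))
    rw [sub_apply, h0, sub_zero] at h2 this
    rw [norm_sub_rev] at this
    rw [Real.norm_eq_abs] at this
    nlinarith [hy1 j, norm_nonneg (h - g j)]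
  have h2 := norm_sub_norm_le h (g j)
  linarith [hy2 j]

/-- Bounded sequences in the dual of a reflexive space have weakly convergent subsequences.
Along a diagonal subsequence the values at a separating sequence of vectors converge; this leaves
only one possible weak-* cluster point, hence forces convergence by Banach–Alaoglu. -/
theorem exists_subseq_weaklyTendsto (hX : IsReflexiveSpace X) {u : ℕ → StrongDual ℝ X} {C : ℝ}
    (hu : ∀ n, ‖u n‖ ≤ C) :
    ∃ (f : StrongDual ℝ X) (φ : ℕ → ℕ), StrictMono φ ∧ WeaklyTendsto (u ∘ φ) f := by
  obtain ⟨y, hy⟩ := exists_seq_separating u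
  have hcomp : IsCompact (univ.pi fun j => Metric.closedBall (0 : ℝ) (C * ‖y j‖)) :=
    isCompact_univ_pi fun j => isCompact_closedBall _ _
  obtain ⟨l, -, φ, hφ, hl⟩ := hcomp.tendsto_subseq (x := fun n j => u n (y j)) fun n j _ => by
    simpa using (u n).le_of_opNorm_le (hu n) (y j)
  rw [tendsto_pi_nhds] at hl
  have hB := WeakDual.isCompact_closedBall (0 : StrongDual ℝ X) C
  let U : ℕ → WeakDual ℝ X := fun n => StrongDual.toWeakDual (u (φ n))
  have hU : ∀ n, U n ∈ WeakDual.toStrongDual ⁻¹' Metric.closedBall (0 : StrongDual ℝ X) C :=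
    fun n => by simpa [U] using hu (φ n)
  have heval : ∀ (f : WeakDual ℝ X), MapClusterPt f atTop U → ∀ z,
      MapClusterPt (f z) atTop (fun n => u (φ n) z) := fun f hf z =>
    hf.continuousAt_comp (WeakDual.eval_continuous z).continuousAt
  have hspan : ∀ f : WeakDual ℝ X, MapClusterPt f atTop U → WeakDual.toStrongDual f ∈
      closure (Submodule.span ℝ (range u) : Set (StrongDual ℝ X)) := by
    intro f hf
    by_contra hn
    obtain ⟨Φ, c, hΦ, hc⟩ := geometric_hahn_banach_closed_point
      (Submodule.span ℝ (range u)).convex.closure isClosed_closure hn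
    obtain ⟨z, rfl⟩ := hX Φ
    have hmem : f z ∈ Iic c := isClosed_Iic.mem_of_mapClusterPt (heval f hf z)
      (Eventually.of_forall fun n =>
        (hΦ (u (φ n)) (subset_closure (Submodule.subset_span (mem_range_self _)))).le)
    exact hc.not_ge hmem
  have hval : ∀ f : WeakDual ℝ X, MapClusterPt f atTop U → ∀ j, f (y j) = l j := fun f hf j =>
    have := NeBot.mono (heval f hf (y j)) (inf_le_inf_left _ (hl j))
    eq_of_nhds_neBot this
  obtain ⟨f, -, hf⟩ := hB.exists_mapClusterPt (f := atTop) (u := U)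
    (tendsto_principal.2 (Eventually.of_forall hU))
  have huniq : ∀ f' : WeakDual ℝ X, MapClusterPt f' atTop U → f' = f := by
    intro f' hf'
    have h0 : WeakDual.toStrongDual f' - WeakDual.toStrongDual f = 0 := by
      refine hy _ ?_ fun j => ?_
      · exact (Submodule.span ℝ (range u)).topologicalClosure.sub_mem (hspan f' hf') (hspan f hf)
      · change f' (y j) - f (y j) = 0
        rw [hval f' hf', hval f hf, sub_self]
    exact WeakDual.toStrongDual.injective (sub_eq_zero.1 h0)
  have htend : Tendsto U atTop (𝓝 f) := hB.tendsto_nhds_of_unique_mapClusterPt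
    (Eventually.of_forall hU) fun f' _ hf' => huniq f' hf'
  refine ⟨WeakDual.toStrongDual f, φ, hφ, (weaklyTendsto_iff_forall_apply hX).2 fun z => ?_⟩
  exact ((WeakDual.eval_continuous z).tendsto f).comp htend

/-- The duality pairing is jointly sequentially continuous for weak convergence in the dual and
norm convergence in the space, since weakly convergent sequences are bounded. -/
theorem WeaklyTendsto.tendsto_apply [CompleteSpace X] {u : ℕ → StrongDual ℝ X}
    {f : StrongDual ℝ X} (h : WeaklyTendsto u f) {y : ℕ → X} {x : X}
    (hy : Tendsto y atTop (𝓝 x)) : Tendsto (fun n => u n (y n)) atTop (𝓝 (f x)) := by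
  have hp : ∀ z, Tendsto (fun n => u n z) atTop (𝓝 (f z)) := fun z =>
    weaklyTendsto_iff_forall_dual.1 h (NormedSpace.inclusionInDoubleDual ℝ X z)
  obtain ⟨C, hC⟩ := banach_steinhaus (g := u) fun z => by
    obtain ⟨c, hc⟩ := (hp z).norm.bddAbove_range
    exact ⟨c, fun n => hc (mem_range_self n)⟩
  have h0 : Tendsto (fun n => u n (y n - x)) atTop (𝓝 0) := by
    have : Tendsto (fun n => C * ‖y n - x‖) atTop (𝓝 0) := by
      simpa using (tendsto_iff_norm_sub_tendsto_zero.1 hy).const_mul C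
    exact squeeze_zero_norm (fun n => (u n).le_of_opNorm_le (hC n) _) this
  simpa using h0.add (hp x)

theorem mul_norm_le_of_forall_apply_le {g : StrongDual ℝ X} {r c : ℝ} (hr : 0 < r)
    (h : ∀ e, ‖e‖ ≤ r → g e ≤ c) : r * ‖g‖ ≤ c := by
  have hc : 0 ≤ c := by simpa using h 0 (by simpa using hr.le)
  have : ‖g‖ ≤ c / r := by
    refine ContinuousLinearMap.opNorm_le_of_unit_norm (by positivity) fun z hz => ?_
    have hn : ‖r • z‖ ≤ r := by rw [norm_smul, hz, mul_one, Real.norm_of_nonneg hr.le]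
    have h1 := h (r • z) hn
    have h2 := h (-(r • z)) (by rwa [norm_neg])
    rw [map_neg] at h2
    rw [map_smul, smul_eq_mul] at h1 h2
    rw [Real.norm_eq_abs, abs_le, le_div_iff₀ hr, neg_le, le_div_iff₀ hr]
    constructor <;> linarith
  rw [le_div_iff₀ hr] at this; linarith

/-! ### Elementary properties of maximal monotone operators -/

theorem IsMaximalMonotone.mem_of_forall {A : X → Set (StrongDual ℝ X)} (hA : IsMaximalMonotone A)
    {x : X} {f : StrongDual ℝ X} (h : ∀ y, ∀ g ∈ A y, 0 ≤ (f - g) (x - y)) : f ∈ A x := by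
  have hB : IsMonotone fun z => {g | g ∈ A z ∨ (z = x ∧ g = f)} := by
    rintro y z g (hg | ⟨rfl, rfl⟩) k (hk | ⟨rfl, rfl⟩)
    · exact hA.1 y z g hg k hk
    · have := h y g hg
      simp only [sub_apply, map_sub] at this ⊢
      linarith
    · exact h z k hk
    · simp
  rw [← hA.2 _ hB fun z g hg => Or.inl hg]
  exact Or.inr ⟨rfl, rfl⟩

theorem IsMaximalMonotone.mem_of_weaklyTendsto [CompleteSpace X] {A : X → Set (StrongDual ℝ X)}
    (hA : IsMaximalMonotone A) {y : ℕ → X} {x : X} {u : ℕ → StrongDual ℝ X} {f : StrongDual ℝ X}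
    (hy : Tendsto y atTop (𝓝 x)) (hu : ∀ n, u n ∈ A (y n)) (h : WeaklyTendsto u f) :
    f ∈ A x := by
  refine hA.mem_of_forall fun z g hg => ?_
  have hyz : Tendsto (fun n => y n - z) atTop (𝓝 (x - z)) := hy.sub_const z
  have := (h.tendsto_apply hyz).sub ((g.continuous.tendsto _).comp hyz)
  exact ge_of_tendsto' this fun n => hA.1 (y n) z (u n) (hu n) g hg

theorem IsMaximalMonotone.convex {A : X → Set (StrongDual ℝ X)} (hA : IsMaximalMonotone A)
    (x : X) : Convex ℝ (A x) := by
  intro f hf g hg a b ha hb hab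
  refine hA.mem_of_forall fun y k hk => ?_
  have h1 := mul_nonneg ha (hA.1 x y f hf k hk)
  have h2 := mul_nonneg hb (hA.1 x y g hg k hk)
  obtain rfl : b = 1 - a := by linarith
  simp only [sub_apply, add_apply,
    smul_apply, smul_eq_mul] at h1 h2 ⊢
  linarith

theorem IsMaximalMonotone.isClosed {A : X → Set (StrongDual ℝ X)} (hA : IsMaximalMonotone A)
    (x : X) : IsClosed (A x) := by
  have : A x = ⋂ y, ⋂ g ∈ A y, {f | 0 ≤ (f - g) (x - y)} := by
    ext f
    simp only [mem_iInter]
    exact ⟨fun hf y g hg => hA.1 x y f hf g hg, hA.mem_of_forall⟩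
  rw [this]
  refine isClosed_iInter fun y => isClosed_biInter fun g _ => isClosed_le continuous_const ?_
  exact (continuous_id.sub continuous_const).clm_apply continuous_const

theorem IsMaximalMonotone.add_mem {A : X → Set (StrongDual ℝ X)} (hA : IsMaximalMonotone A)
    {x : X} {f n : StrongDual ℝ X} (hf : f ∈ A x) (hn : n ∈ normalCone x (closure (dom A))) :
    f + n ∈ A x := by
  refine hA.mem_of_forall fun y g hg => ?_
  have h1 := hA.1 x y f hf g hg
  have h2 := hn y (subset_closure ⟨g, hg⟩)
  simp only [sub_apply, add_apply, map_sub] at h1 h2 ⊢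
  linarith

/-! ### Affine minorants and interior points of the domain -/

/-- For each `e` in the closed ball of radius `ρ` around `0`, the function `g (y - (x + e))` on the
graph of `A` is bounded below by an affine function `p (y - x) - K` of `y`, where `‖p‖ ≤ M` and the
constants `M` and `K` do not depend on `e`. The inequality is written with `g e` isolated. -/
def HasAffineMinorants (A : X → Set (StrongDual ℝ X)) (x : X) (ρ M K : ℝ) : Prop :=
  ∀ e, ‖e‖ ≤ ρ → ∃ p : StrongDual ℝ X, ‖p‖ ≤ M ∧
    ∀ y, ∀ g ∈ A y, g e ≤ g (y - x) - p (y - x) + K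

theorem HasAffineMinorants.nonneg {A : X → Set (StrongDual ℝ X)} {x : X} {ρ M K : ℝ}
    (h : HasAffineMinorants A x ρ M K) (hρ : 0 ≤ ρ) : 0 ≤ M := by
  obtain ⟨p, hp, -⟩ := h 0 (by simpa using hρ)
  exact (norm_nonneg p).trans hp

theorem HasAffineMinorants.mul_norm_le {A : X → Set (StrongDual ℝ X)} {x : X} {ρ M K : ℝ}
    (h : HasAffineMinorants A x ρ M K) (hρ : 0 < ρ) {y : X} {g : StrongDual ℝ X} (hg : g ∈ A y) :
    ρ * ‖g‖ ≤ g (y - x) + M * ‖y - x‖ + K := by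
  refine mul_norm_le_of_forall_apply_le hρ fun e he => ?_
  obtain ⟨p, hp, hpg⟩ := h e he
  have h1 := hpg y g hg
  have h2 := neg_le_of_abs_le (p.le_of_opNorm_le hp (y - x))
  linarith

theorem HasAffineMinorants.translate {A : X → Set (StrongDual ℝ X)} {x : X} {ρ M K : ℝ}
    (h : HasAffineMinorants A x ρ M K) {d : X} (hd : ‖d‖ ≤ ρ / 2) :
    HasAffineMinorants A (x + d) (ρ / 2) M (K + M * (ρ / 2)) := by
  intro e he
  obtain ⟨p, hp, hpg⟩ := h (e + d) ((norm_add_le _ _).trans (by linarith))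
  refine ⟨p, hp, fun y g hg => ?_⟩
  have h1 := hpg y g hg
  have h2 := neg_le_of_abs_le (p.le_of_opNorm_le hp d)
  have h3 : M * ‖d‖ ≤ M * (ρ / 2) := mul_le_mul_of_nonneg_left hd ((norm_nonneg p).trans hp)
  rw [← sub_sub, map_sub g _ d, map_sub p _ d]
  rw [map_add] at h1
  linarith

/-- Monotonicity passes to convex combinations of points of the graph: the mean of the values
`g (h)` dominates the pairing of the means. The diagonal case of a bilinear inequality is reached
by convexifying one variable at a time. -/
theorem apply_le_of_mem_convexHull {T : Set (X × StrongDual ℝ X × ℝ)}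
    (hT : ∀ a ∈ T, ∀ b ∈ T, b.2.1 a.1 + a.2.1 b.1 ≤ a.2.2 + b.2.2)
    {a : X × StrongDual ℝ X × ℝ} (ha : a ∈ convexHull ℝ T) : a.2.1 a.1 ≤ a.2.2 := by
  have hconv : ∀ b : X × StrongDual ℝ X × ℝ,
      Convex ℝ {a : X × StrongDual ℝ X × ℝ | b.2.1 a.1 + a.2.1 b.1 - a.2.2 ≤ b.2.2} := by
    intro b
    refine convex_halfSpace_le ⟨fun x y => ?_, fun c x => ?_⟩ _
    · simp only [Prod.fst_add, Prod.snd_add, map_add, add_apply]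
      ring
    · simp only [Prod.smul_fst, Prod.smul_snd, map_smul, smul_apply, smul_eq_mul]
      ring
  have h1 : ∀ b ∈ T, ∀ a ∈ convexHull ℝ T, b.2.1 a.1 + a.2.1 b.1 - a.2.2 ≤ b.2.2 := fun b hb =>
    convexHull_min (fun a ha => by
      have := hT a ha b hb
      change b.2.1 a.1 + a.2.1 b.1 - a.2.2 ≤ b.2.2
      linarith) (hconv b)
  have h2 : ∀ a ∈ convexHull ℝ T, ∀ b ∈ convexHull ℝ T,
      a.2.1 b.1 + b.2.1 a.1 - b.2.2 ≤ a.2.2 := fun a ha =>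
    convexHull_min (fun b hb => by
      have := h1 b hb a ha
      change a.2.1 b.1 + b.2.1 a.1 - b.2.2 ≤ a.2.2
      linarith) (hconv a)
  linarith [h2 a ha a ha]

/-- A convex set in `X × ℝ` on which the last coordinate is bounded below by `-L‖·‖` lies above
the graph of a continuous linear functional. -/
theorem exists_dual_le_of_neg_norm_le {E : Set (X × ℝ)} (hE : Convex ℝ E) (hne : E.Nonempty)
    {L : ℝ} (hL : 0 ≤ L) (h : ∀ a ∈ E, -(L * ‖a.1‖) ≤ a.2) :
    ∃ f : StrongDual ℝ X, ∀ a ∈ E, f a.1 ≤ a.2 := by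
  let S : Set (X × ℝ) := {a | a.2 + L * ‖a.1‖ < 0}
  have hSo : IsOpen S := isOpen_lt (by fun_prop) continuous_const
  have hSc : Convex ℝ S := by
    have : ConvexOn ℝ univ fun a : X × ℝ => a.2 + L * ‖a.1‖ :=
      ((LinearMap.snd ℝ X ℝ).convexOn convex_univ).add
        (((convexOn_norm convex_univ).comp_linearMap (LinearMap.fst ℝ X ℝ)).smul hL)
    simpa [S] using this.convex_lt 0
  have hdisj : Disjoint S E := disjoint_left.2 fun a ha hb => by
    have h1 := h a hb
    change a.2 + L * ‖a.1‖ < 0 at ha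
    linarith
  obtain ⟨F, c, hFS, hFE⟩ := geometric_hahn_banach_open hSc hSo hE hdisj
  have hF : ∀ a : X × ℝ, F a = F (a.1, 0) + F (0, 1) * a.2 := fun a => by
    have : a = (a.1, 0) + a.2 • (0, 1) := by ext <;> simp
    conv_lhs => rw [this, map_add, map_smul, smul_eq_mul]
    ring
  obtain ⟨a, ha⟩ := hne
  have hα : 0 < F (0, 1) := by
    have h1 := hFS (a.1, -(L * ‖a.1‖) - 1) (by change -(L * ‖a.1‖) - 1 + L * ‖a.1‖ < 0; linarith)
    have h2 := hFE a ha
    rw [hF] at h1 h2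
    have h3 := h a ha
    by_contra hn
    nlinarith
  have hc : 0 ≤ c := by
    by_contra hn
    push Not at hn
    have h1 := hFS (0, c / F (0, 1)) (by simpa [S] using div_neg_of_neg_of_pos hn hα)
    rw [hF] at h1
    simp only [Prod.mk_zero_zero, map_zero, zero_add, mul_div_cancel₀ c hα.ne'] at h1
    exact lt_irrefl _ h1
  refine ⟨-(F (0, 1))⁻¹ • F.comp (ContinuousLinearMap.inl ℝ X ℝ), fun b hb => ?_⟩
  have h1 := hFE b hb
  rw [hF] at h1
  simp only [smul_apply, ContinuousLinearMap.comp_apply, ContinuousLinearMap.inl_apply,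
    smul_eq_mul]
  rw [neg_mul, neg_le, ← sub_nonneg]
  have : (F (0, 1))⁻¹ * F (b.1, 0) - -b.2 = (F (0, 1))⁻¹ * (F (b.1, 0) + F (0, 1) * b.2) := by
    field_simp
    ring
  rw [this]
  exact mul_nonneg (inv_nonneg.2 hα.le) (hc.trans h1)

/-- Uniform affine minorants around `x` force `x` into the domain. For a convex combination
`(h, g, q)` of triples `(y - x, g, g (y - x))` over the graph, monotonicity gives
`q ≥ g h ≥ -‖g‖ * ‖h‖`, which is used when `‖g‖` is small, and the minorants give
`q ≥ ρ * ‖g‖ - M * ‖h‖ - K`, which is used when `‖g‖` is large. So `q ≥ -L * ‖h‖`, and a linear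
functional between the two sides is monotonically related to the graph at `x`. -/
theorem HasAffineMinorants.mem_dom {A : X → Set (StrongDual ℝ X)} (hA : IsMaximalMonotone A)
    (hne : (dom A).Nonempty) {x : X} {ρ M K : ℝ} (hρ : 0 < ρ) (hK : 0 ≤ K)
    (h : HasAffineMinorants A x ρ M K) : x ∈ dom A := by
  let T : Set (X × StrongDual ℝ X × ℝ) := {a | ∃ y, ∃ g ∈ A y, a = (y - x, g, g (y - x))}
  have hM := h.nonneg hρ.le
  have hlow : ∀ a ∈ convexHull ℝ T, a.2.1 a.1 ≤ a.2.2 := by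
    refine fun a ha => apply_le_of_mem_convexHull ?_ ha
    rintro _ ⟨y, g, hg, rfl⟩ _ ⟨z, k, hk, rfl⟩
    have := hA.1 y z g hg k hk
    simp only [sub_apply, map_sub] at this ⊢
    linarith
  have hhigh : ∀ a ∈ convexHull ℝ T, ρ * ‖a.2.1‖ ≤ a.2.2 + M * ‖a.1‖ + K := by
    refine fun a ha => mul_norm_le_of_forall_apply_le hρ fun e he => ?_
    obtain ⟨p, hp, hpg⟩ := h e he
    have hconv : Convex ℝ {a : X × StrongDual ℝ X × ℝ | a.2.1 e - a.2.2 + p a.1 ≤ K} := by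
      refine convex_halfSpace_le ⟨fun x y => ?_, fun c x => ?_⟩ _
      · simp only [Prod.fst_add, Prod.snd_add, map_add, add_apply]
        ring
      · simp only [Prod.smul_fst, Prod.smul_snd, map_smul, smul_apply, smul_eq_mul]
        ring
    have h1 : a.2.1 e - a.2.2 + p a.1 ≤ K := by
      refine convexHull_min ?_ hconv ha
      rintro _ ⟨y, g, hg, rfl⟩
      have := hpg y g hg
      change g e - g (y - x) + p (y - x) ≤ K
      linarith
    have h2 := neg_le_of_abs_le (p.le_of_opNorm_le hp a.1)
    linarith
  let E : Set (X × ℝ) :=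
    ((LinearMap.fst ℝ X (StrongDual ℝ X × ℝ)).prod
      (LinearMap.snd ℝ (StrongDual ℝ X) ℝ ∘ₗ LinearMap.snd ℝ X (StrongDual ℝ X × ℝ))) ''
      convexHull ℝ T
  have hmem : ∀ y, ∀ g ∈ A y, (y - x, g (y - x)) ∈ E := fun y g hg =>
    ⟨_, subset_convexHull ℝ T ⟨y, g, hg, rfl⟩, rfl⟩
  obtain ⟨f, hf⟩ : ∃ f : StrongDual ℝ X, ∀ a ∈ E, f a.1 ≤ a.2 := by
    refine exists_dual_le_of_neg_norm_le ((convex_convexHull ℝ T).linear_image _) ?_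
      (L := M + K / ρ) (by positivity) ?_
    · obtain ⟨y, g, hg⟩ := hne
      exact ⟨_, hmem y g hg⟩
    · rintro _ ⟨a, ha, rfl⟩
      change -((M + K / ρ) * ‖a.1‖) ≤ a.2.2
      have h1 := hlow a ha
      have h2 := hhigh a ha
      have h3 := neg_le_of_abs_le (a.2.1.le_opNorm a.1)
      have hn := norm_nonneg a.1
      have hKρ : 0 ≤ K / ρ * ‖a.1‖ := by positivity
      rcases le_total ‖a.2.1‖ (K / ρ) with hs | hs
      · have := mul_le_mul_of_nonneg_right hs hn
        have := mul_nonneg hM hn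
        linarith
      · rw [div_le_iff₀ hρ] at hs
        linarith
  refine ⟨f, hA.mem_of_forall fun y g hg => ?_⟩
  have := hf _ (hmem y g hg)
  simp only [sub_apply, map_sub] at this ⊢
  linarith

theorem HasAffineMinorants.mem_interior_dom {A : X → Set (StrongDual ℝ X)}
    (hA : IsMaximalMonotone A) (hne : (dom A).Nonempty) {x : X} {ρ M K : ℝ} (hρ : 0 < ρ)
    (hK : 0 ≤ K) (h : HasAffineMinorants A x ρ M K) : x ∈ interior (dom A) := by
  rw [mem_interior_iff_mem_nhds]
  refine mem_of_superset (Metric.closedBall_mem_nhds x (half_pos hρ)) fun z hz => ?_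
  rw [mem_closedBall_iff_norm] at hz
  have hM := h.nonneg hρ.le
  have := h.translate hz
  rw [add_sub_cancel] at this
  exact this.mem_dom hA hne (half_pos hρ) (by positivity)

/-- Bounded values on a ball around `c` yield affine minorants at every point of a half-open
segment from `c` to the domain: a ball around such a point consists of convex combinations of the
same end point and points of the ball around `c`. -/
theorem exists_hasAffineMinorants_of_bounded {A : X → Set (StrongDual ℝ X)} (hA : IsMonotone A)
    {c b : X} {r n : ℝ} (hr : 0 < r)
    (hc : ∀ z, ‖z - c‖ ≤ r → ∃ p ∈ A z, ‖p‖ ≤ n) (hb : b ∈ dom A) {α β : ℝ} (hα : 0 < α)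
    (hβ : 0 ≤ β) (hαβ : α + β = 1) :
    ∃ ρ M K, 0 < ρ ∧ 0 ≤ K ∧ HasAffineMinorants A (α • c + β • b) ρ M K := by
  obtain ⟨q, hq⟩ := hb
  have hn : 0 ≤ n := by
    obtain ⟨p, -, hp⟩ := hc c (by simpa using hr.le)
    exact (norm_nonneg p).trans hp
  set x := α • c + β • b with hx
  refine ⟨α * r, n + ‖q‖, n * (‖c - x‖ + r) + ‖q‖ * ‖b - x‖, by positivity, by positivity,
    fun e he => ?_⟩
  have he' : ‖α⁻¹ • e‖ ≤ r := by
    rw [norm_smul, norm_inv, Real.norm_of_nonneg hα.le, inv_mul_le_iff₀ hα]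
    exact he
  obtain ⟨p, hp, hpn⟩ := hc (c + α⁻¹ • e) (by simpa using he')
  refine ⟨α • p + β • q, ?_, fun y g hg => ?_⟩
  · refine (norm_add_le _ _).trans ?_
    rw [norm_smul, norm_smul, Real.norm_of_nonneg hα.le, Real.norm_of_nonneg hβ]
    have := mul_le_mul_of_nonneg_right (show α ≤ 1 by linarith) (norm_nonneg p)
    have := mul_le_mul_of_nonneg_right (show β ≤ 1 by linarith) (norm_nonneg q)
    linarith
  have h1 := mul_nonneg hα.le (hA y _ g hg p hp)
  have h2 := mul_nonneg hβ (hA y _ g hg q hq)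
  have h3 : α * p (c + α⁻¹ • e - x) ≤ n * (‖c - x‖ + r) := by
    have h4 : ‖c + α⁻¹ • e - x‖ ≤ ‖c - x‖ + r := by
      rw [add_sub_right_comm]
      exact (norm_add_le _ _).trans (by linarith)
    have h5 : p (c + α⁻¹ • e - x) ≤ n * (‖c - x‖ + r) :=
      (le_of_abs_le (p.le_of_opNorm_le hpn _)).trans (mul_le_mul_of_nonneg_left h4 hn)
    have h6 : 0 ≤ n * (‖c - x‖ + r) := by positivity
    nlinarith
  have h7 : β * q (b - x) ≤ ‖q‖ * ‖b - x‖ := by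
    have h5 := le_of_abs_le (q.le_opNorm (b - x))
    have h6 : 0 ≤ ‖q‖ * ‖b - x‖ := by positivity
    nlinarith
  have hgx : g x = α * g c + β * g b := by simp [hx]
  have hge : α * (α⁻¹ * g e) = g e := by field_simp
  obtain rfl : β = 1 - α := by linarith
  simp only [sub_apply, add_apply, smul_apply, map_sub, map_add, map_smul, smul_eq_mul]
    at h1 h2 h3 h7 ⊢
  linarith

/-- By Baire's theorem a maximal monotone operator has bounded values on some ball: the sets of
points with a value of norm at most `n` are closed by weak sequential compactness. -/
theorem exists_ball_bounded [CompleteSpace X] (hX : IsReflexiveSpace X)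
    {A : X → Set (StrongDual ℝ X)} (hA : IsMaximalMonotone A)
    (hint : (interior (dom A)).Nonempty) :
    ∃ (c : X) (r n : ℝ), 0 < r ∧ ∀ z, ‖z - c‖ ≤ r → ∃ p ∈ A z, ‖p‖ ≤ n := by
  let F : ℕ → Set X := fun n => {z | ∃ p ∈ A z, ‖p‖ ≤ n}
  have hF : ∀ n, IsClosed (F n) := by
    refine fun n => IsSeqClosed.isClosed fun z a hz ha => ?_
    choose p hp hpn using hz
    obtain ⟨f, φ, hφ, hf⟩ := exists_subseq_weaklyTendsto hX hpn
    refine ⟨f, hA.mem_of_weaklyTendsto (ha.comp hφ.tendsto_atTop) (fun k => hp (φ k)) hf, ?_⟩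
    have := hf.mem_of_convex_of_isClosed (convex_closedBall 0 (n : ℝ)) Metric.isClosed_closedBall
      fun k => by simpa using hpn (φ k)
    simpa using this
  have hcov : ⋃ n, (F n ∪ (interior (dom A))ᶜ) = univ := by
    refine eq_univ_of_forall fun z => mem_iUnion.2 ?_
    by_cases hz : z ∈ interior (dom A)
    · obtain ⟨p, hp⟩ := interior_subset hz
      obtain ⟨n, hn⟩ := exists_nat_ge ‖p‖
      exact ⟨n, Or.inl ⟨p, hp, hn⟩⟩
    · exact ⟨0, Or.inr hz⟩
  have hd := dense_iUnion_interior_of_closed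
    (fun n => (hF n).union isOpen_interior.isClosed_compl) hcov
  obtain ⟨c, hc, hcU⟩ := hd.inter_open_nonempty _ isOpen_interior hint
  obtain ⟨n, hn⟩ := mem_iUnion.1 hcU
  have hnhds : F n ∈ 𝓝 c := by
    filter_upwards [isOpen_interior.mem_nhds hc, mem_interior_iff_mem_nhds.1 hn] with z h1 h2
    exact h2.resolve_right fun h => h h1
  obtain ⟨r, hr, hsub⟩ := Metric.nhds_basis_closedBall.mem_iff.1 hnhds
  exact ⟨c, r, n, hr, fun z hz => hsub (mem_closedBall_iff_norm.2 hz)⟩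

theorem exists_hasAffineMinorants [CompleteSpace X] (hX : IsReflexiveSpace X)
    {A : X → Set (StrongDual ℝ X)} (hA : IsMaximalMonotone A) {x : X}
    (hx : x ∈ interior (dom A)) :
    ∃ ρ M K, 0 < ρ ∧ 0 ≤ K ∧ HasAffineMinorants A x ρ M K := by
  obtain ⟨c, r, n, hr, hc⟩ := exists_ball_bounded hX hA ⟨x, hx⟩
  -- The segment from `c` to `x` can be prolonged inside the domain beyond the interior point `x`.
  have hlim : Tendsto (fun δ : ℝ => x + δ • (x - c)) (𝓝[>] 0) (𝓝 x) := by
    have : Continuous fun δ : ℝ => x + δ • (x - c) := by fun_prop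
    simpa using (this.tendsto 0).mono_left nhdsWithin_le_nhds
  obtain ⟨δ, hδ, hδ0⟩ := ((hlim.eventually (mem_interior_iff_mem_nhds.1 hx)).and
    self_mem_nhdsWithin).exists
  replace hδ0 : 0 < δ := hδ0
  have hpos : 0 < 1 + δ := by linarith
  have := exists_hasAffineMinorants_of_bounded hA.1 hr hc hδ (α := δ / (1 + δ))
    (β := 1 / (1 + δ)) (by positivity) (by positivity) (by field_simp; ring)
  have hxe : (δ / (1 + δ)) • c + (1 / (1 + δ)) • (x + δ • (x - c)) = x := by
    have h1 : (1 / (1 + δ)) * (1 + δ) = 1 := by field_simp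
    calc _ = ((1 / (1 + δ)) * (1 + δ)) • x := by module
      _ = x := by rw [h1, one_smul]
  rwa [hxe] at this

theorem openSegment_subset_interior_dom [CompleteSpace X] (hX : IsReflexiveSpace X)
    {A : X → Set (StrongDual ℝ X)} (hA : IsMaximalMonotone A) {a b : X}
    (ha : a ∈ interior (dom A)) (hb : b ∈ dom A) : openSegment ℝ a b ⊆ interior (dom A) := by
  rintro _ ⟨α, β, hα, hβ, hαβ, rfl⟩
  obtain ⟨ρ, M, K, hρ, hK, h⟩ := exists_hasAffineMinorants hX hA ha
  have hM := h.nonneg hρ.le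
  obtain ⟨r, hr, hsub⟩ := Metric.nhds_basis_closedBall.mem_iff.1 (mem_interior_iff_mem_nhds.1 ha)
  have hball : ∀ z, ‖z - a‖ ≤ min r (ρ / 2) → ∃ p ∈ A z, ‖p‖ ≤ (M * (ρ / 2) + K) / (ρ / 2) := by
    intro z hz
    obtain ⟨p, hp⟩ := hsub (mem_closedBall_iff_norm.2 (hz.trans (min_le_left _ _)))
    have hz' := hz.trans (min_le_right _ _)
    refine ⟨p, hp, ?_⟩
    rw [le_div_iff₀ (half_pos hρ)]
    have h1 := h.mul_norm_le hρ hp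
    have h2 := le_of_abs_le (p.le_opNorm (z - a))
    have h3 := mul_le_mul_of_nonneg_left hz' (norm_nonneg p)
    have h4 := mul_le_mul_of_nonneg_left hz' hM
    linarith
  obtain ⟨ρ', M', K', hρ', hK', h'⟩ := exists_hasAffineMinorants_of_bounded hA.1
    (lt_min hr (half_pos hρ)) hball hb hα hβ.le hαβ
  exact h'.mem_interior_dom hA ⟨b, hb⟩ hρ' hK'

theorem convex_interior_dom [CompleteSpace X] (hX : IsReflexiveSpace X)
    {A : X → Set (StrongDual ℝ X)} (hA : IsMaximalMonotone A) : Convex ℝ (interior (dom A)) :=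
  convex_iff_openSegment_subset.2 fun _ ha _ hb =>
    openSegment_subset_interior_dom hX hA ha (interior_subset hb)

theorem closure_interior_dom [CompleteSpace X] (hX : IsReflexiveSpace X)
    {A : X → Set (StrongDual ℝ X)} (hA : IsMaximalMonotone A)
    (hint : (interior (dom A)).Nonempty) : closure (interior (dom A)) = closure (dom A) := by
  refine (closure_mono interior_subset).antisymm (closure_minimal (fun b hb => ?_) isClosed_closure)
  obtain ⟨a, ha⟩ := hint
  have := closure_mono (openSegment_subset_interior_dom hX hA ha hb)
  rw [closure_openSegment] at this
  exact this (right_mem_segment ℝ a b)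

/-! ### Directional weak limits and the representation -/

theorem weakLimsupDir_subset_weakLimsup (s : X → StrongDual ℝ X) (D : Set X) (x v : X) :
    weakLimsupDir s D x v ⊆ weakLimsup s D x := by
  rintro f ⟨w, t, hw, -, ht, hD, hf⟩
  refine ⟨fun n => x + t n • w n, ?_, hD, hf⟩
  simpa using tendsto_const_nhds.add (ht.smul hw)

theorem weakLimsup_subset [CompleteSpace X] {A : X → Set (StrongDual ℝ X)}
    (hA : IsMaximalMonotone A) {D : Set X} (hD : D ⊆ dom A) {s : X → StrongDual ℝ X}
    (hs : IsSelection s A) (x : X) : weakLimsup s D x ⊆ A x := by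
  rintro f ⟨y, hy, hyD, hf⟩
  exact hA.mem_of_weaklyTendsto hy (fun n => hs _ (hD (hyD n))) hf

/-- In a direction `v` pointing into the interior of the domain, the selection stays bounded near
the half-line from `x`, and monotonicity against `f ∈ A x` makes any weak limit dominate `f` at
`v`. -/
theorem exists_mem_weakLimsupDir_le [CompleteSpace X] (hX : IsReflexiveSpace X)
    {A : X → Set (StrongDual ℝ X)} (hA : IsMaximalMonotone A) {D : Set X} (hDsub : D ⊆ dom A)
    (hDdense : dom A ⊆ closure D) {s : X → StrongDual ℝ X} (hs : IsSelection s A) {x v : X}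
    {f : StrongDual ℝ X} (hf : f ∈ A x) (hv : x + v ∈ interior (dom A)) :
    ∃ k ∈ weakLimsupDir s D x v, f v ≤ k v := by
  obtain ⟨ρ, M, K, hρ, hK, h⟩ := exists_hasAffineMinorants hX hA hv
  have hM := h.nonneg hρ.le
  let t : ℕ → ℝ := fun n => 1 / ((n : ℝ) + 2)
  have ht0 : ∀ n, 0 < t n := fun n => by positivity
  have ht1 : ∀ n, t n ≤ 1 := fun n => by
    rw [div_le_one (by positivity)]
    linarith [n.cast_nonneg (α := ℝ)]
  have htl : ∀ n, t n < 1 := fun n => by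
    rw [div_lt_one (by positivity)]
    linarith [n.cast_nonneg (α := ℝ)]
  have htlim : Tendsto t atTop (𝓝 0) := by
    have := (tendsto_add_atTop_iff_nat 1).2
      (tendsto_one_div_add_atTop_nhds_zero_nat (𝕜 := ℝ))
    refine this.congr fun n => ?_
    simp only [t]
    push_cast
    ring
  have hex : ∀ n, ∃ w : X, x + t n • w ∈ D ∧ ‖w - v‖ ≤ ρ / 2 * t n := by
    intro n
    have hxt : x + t n • v ∈ dom A := by
      refine interior_subset (openSegment_subset_interior_dom hX hA hv ⟨f, hf⟩
        ⟨t n, 1 - t n, ht0 n, by linarith [htl n], by ring, by module⟩)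
    obtain ⟨y, hyD, hy⟩ := Metric.mem_closure_iff.1 (hDdense hxt) (t n * (ρ / 2 * t n))
      (mul_pos (ht0 n) (mul_pos (half_pos hρ) (ht0 n)))
    refine ⟨(t n)⁻¹ • (y - x), ?_, ?_⟩
    · rwa [smul_inv_smul₀ (ht0 n).ne', add_sub_cancel]
    · have : (t n)⁻¹ • (y - x) - v = (t n)⁻¹ • (y - (x + t n • v)) := by
        rw [← sub_sub, smul_sub _ (y - x), inv_smul_smul₀ (ht0 n).ne']
      rw [this, norm_smul, norm_inv, Real.norm_of_nonneg (ht0 n).le, inv_mul_le_iff₀ (ht0 n),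
        ← dist_eq_norm, dist_comm]
      exact hy.le
  choose w hwD hw using hex
  have hwlim : Tendsto w atTop (𝓝 v) := by
    rw [tendsto_iff_norm_sub_tendsto_zero]
    exact squeeze_zero (fun n => norm_nonneg _) hw (by simpa using htlim.const_mul (ρ / 2))
  have hsA : ∀ n, s (x + t n • w n) ∈ A (x + t n • w n) := fun n => hs _ (hDsub (hwD n))
  have hmono : ∀ n, f (w n) ≤ s (x + t n • w n) (w n) := by
    intro n
    have h1 := hA.1 _ x _ (hsA n) f hf
    rw [add_sub_cancel_left, map_smul, smul_eq_mul, mul_nonneg_iff_of_pos_left (ht0 n),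
      sub_apply, sub_nonneg] at h1
    exact h1
  have hbdd : ∀ n, ‖s (x + t n • w n)‖ ≤
      (‖f‖ * (‖v‖ + ρ) + M * (‖v‖ + ρ + ‖v‖) + K) / (ρ / 2) := by
    intro n
    set g := s (x + t n • w n) with hg
    have hwv : ‖w n - v‖ ≤ ρ / 2 := (hw n).trans (mul_le_of_le_one_right (half_pos hρ).le (ht1 n))
    have hwn : ‖w n‖ ≤ ‖v‖ + ρ := by
      have := norm_le_norm_add_norm_sub' (w n) v
      linarith
    have h1 := h.mul_norm_le hρ (hsA n)
    rw [add_sub_add_left_eq_sub] at h1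
    -- Only the part of `g (t • w - v)` along `w` is controlled by monotonicity, with the factor
    -- `t - 1 ≤ 0`; the remainder `g (w - v)` is absorbed by `ρ * ‖g‖`.
    have h2 : g (t n • w n - v) = g (w n - v) - (1 - t n) * g (w n) := by
      simp only [map_sub, map_smul, smul_eq_mul]
      ring
    have h3 := (le_of_abs_le (g.le_opNorm (w n - v))).trans
      (mul_le_mul_of_nonneg_left hwv (norm_nonneg g))
    have h4 := mul_le_mul_of_nonneg_left (hmono n) (sub_nonneg.2 (ht1 n))
    have h5 : -((1 - t n) * f (w n)) ≤ ‖f‖ * (‖v‖ + ρ) := by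
      have h6 := neg_le_of_abs_le (f.le_opNorm (w n))
      have h7 := mul_le_mul_of_nonneg_left hwn (norm_nonneg f)
      have h8 : 0 ≤ ‖f‖ * (‖v‖ + ρ) := by positivity
      nlinarith [ht0 n, ht1 n]
    have h9 : ‖t n • w n - v‖ ≤ ‖v‖ + ρ + ‖v‖ := by
      refine (norm_sub_le _ _).trans ?_
      rw [norm_smul, Real.norm_of_nonneg (ht0 n).le]
      have := mul_le_mul_of_nonneg_right (ht1 n) (norm_nonneg (w n))
      linarith
    have h10 := mul_le_mul_of_nonneg_left h9 hM
    rw [le_div_iff₀ (half_pos hρ)]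
    rw [← hg] at h1
    linarith
  obtain ⟨k, φ, hφ, hk⟩ := exists_subseq_weaklyTendsto hX hbdd
  have hwφ : Tendsto (w ∘ φ) atTop (𝓝 v) := hwlim.comp hφ.tendsto_atTop
  refine ⟨k, ⟨w ∘ φ, t ∘ φ, hwφ, fun n => ht0 _, htlim.comp hφ.tendsto_atTop,
    fun n => hwD _, hk⟩, ?_⟩
  exact le_of_tendsto_of_tendsto' ((f.continuous.tendsto _).comp hwφ) (hk.tendsto_apply hwφ)
    fun n => hmono (φ n)

/-- A direction in the polar of the normal cone, perturbed towards the interior of the domain,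
meets the interior. Otherwise the half-line in that direction could be separated from the interior
by a normal vector that is strictly negative on interior directions. -/
theorem exists_pos_add_smul_mem_interior_dom [CompleteSpace X] (hX : IsReflexiveSpace X)
    {A : X → Set (StrongDual ℝ X)} (hA : IsMaximalMonotone A) {x v v₀ : X}
    (hv : ∀ n ∈ normalCone x (closure (dom A)), n v ≤ 0) (hv₀ : x + v₀ ∈ interior (dom A))
    {ε : ℝ} (hε : 0 < ε) : ∃ c : ℝ, 0 < c ∧ x + c • (v + ε • v₀) ∈ interior (dom A) := by
  by_contra hno
  push Not at hno
  set w := v + ε • v₀ with hw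
  have hconv : Convex ℝ ((fun c : ℝ => x + c • w) '' Ioi 0) := by
    rintro _ ⟨c, hc, rfl⟩ _ ⟨d, hd, rfl⟩ a b ha hb hab
    refine ⟨a * c + b * d, ?_, ?_⟩
    · exact (convex_Ioi (0 : ℝ)) hc hd ha hb hab
    · obtain rfl : b = 1 - a := by linarith
      module
  have hdisj : Disjoint (interior (dom A)) ((fun c : ℝ => x + c • w) '' Ioi 0) := by
    rw [disjoint_left]
    rintro _ hz ⟨c, hc, rfl⟩
    exact hno c hc hz
  obtain ⟨F, u, hFs, hFt⟩ := geometric_hahn_banach_open (convex_interior_dom hX hA)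
    isOpen_interior hconv hdisj
  have hray : ∀ c : ℝ, 0 < c → u ≤ F x + c * F w := fun c hc => by
    simpa using hFt _ ⟨c, hc, rfl⟩
  have hux : u ≤ F x := by
    have hcont : Continuous fun c : ℝ => F x + c * F w := by fun_prop
    have hlim : Tendsto (fun c : ℝ => F x + c * F w) (𝓝[>] 0) (𝓝 (F x)) := by
      simpa using (hcont.tendsto 0).mono_left nhdsWithin_le_nhds
    exact ge_of_tendsto hlim (eventually_mem_nhdsWithin.mono hray)
  have hF : F ∈ normalCone x (closure (dom A)) := by
    intro y hy
    rw [← closure_interior_dom hX hA ⟨_, hv₀⟩] at hy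
    have : F y ≤ u := closure_minimal (t := {z | F z ≤ u}) (fun z hz => (hFs z hz).le)
      (isClosed_le F.continuous continuous_const) hy
    rw [map_sub]
    linarith
  have h1 := hFs _ hv₀
  rw [map_add] at h1
  have h2 : F w < 0 := by
    have := hv F hF
    rw [hw, map_add, map_smul, smul_eq_mul]
    nlinarith
  have h3 := hray (F v₀ / F w) (div_pos_of_neg_of_neg (by linarith) h2)
  rw [div_mul_cancel₀ _ h2.ne] at h3
  linarith

/-- The sum of a closed convex subset of `A x` and the normal cone is closed: along a convergent
sequence of sums, the summands in `A x` are bounded, because an interior direction `v₀` satisfies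
`k v₀ + ρ * ‖k‖ ≤ C` on `A x` and is nonpositive on the normal cone. -/
theorem isClosed_add_normalCone [CompleteSpace X] (hX : IsReflexiveSpace X)
    {A : X → Set (StrongDual ℝ X)} {x v₀ : X}
    (hv₀ : x + v₀ ∈ closure (dom A)) {ρ C : ℝ} (hρ : 0 < ρ)
    (hC : ∀ k ∈ A x, k v₀ + ρ * ‖k‖ ≤ C) {S : Set (StrongDual ℝ X)} (hS : S ⊆ A x)
    (hconv : Convex ℝ S) (hcl : IsClosed S) :
    IsClosed (S + normalCone x (closure (dom A))) := by
  refine IsSeqClosed.isClosed fun u g hu hug => ?_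
  choose k hk n hn hkn using hu
  obtain ⟨B, hB⟩ := hug.norm.bddAbove_range
  have hbdd : ∀ i, ‖k i‖ ≤ (C + B * ‖v₀‖) / ρ := by
    intro i
    rw [le_div_iff₀ hρ]
    have h1 := hC _ (hS (hk i))
    have h2 := hn i _ hv₀
    rw [add_sub_cancel_left] at h2
    have h3 : u i v₀ = k i v₀ + n i v₀ := by rw [← hkn i]; rfl
    have h4 := neg_le_of_abs_le ((u i).le_of_opNorm_le (hB (mem_range_self i)) v₀)
    linarith
  obtain ⟨f, φ, hφ, hf⟩ := exists_subseq_weaklyTendsto hX hbdd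
  refine ⟨f, hf.mem_of_convex_of_isClosed hconv hcl fun i => hk _, g - f, fun y hy => ?_,
    add_sub_cancel f g⟩
  have hkf := (weaklyTendsto_iff_forall_apply hX).1 hf (y - x)
  have hg : Tendsto (fun i => u (φ i) (y - x)) atTop (𝓝 (g (y - x))) :=
    (((ContinuousLinearMap.apply ℝ ℝ (y - x)).continuous.tendsto g).comp hug).comp
      hφ.tendsto_atTop
  refine le_of_tendsto' (hg.sub hkf) fun i => ?_
  have h1 : u (φ i) (y - x) = k (φ i) (y - x) + n (φ i) (y - x) := by rw [← hkn (φ i)]; rfl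
  have h2 := hn (φ i) y hy
  simp only [Function.comp_apply]
  linarith

theorem convex_normalCone (x : X) (S : Set X) : Convex ℝ (normalCone x S) := by
  intro f hf g hg a b ha hb _ y hy
  have h1 := mul_nonpos_of_nonneg_of_nonpos ha (hf y hy)
  have h2 := mul_nonpos_of_nonneg_of_nonpos hb (hg y hy)
  simpa using add_nonpos h1 h2

/-- A functional in `A x` outside the right-hand side would be strictly separated from it by a
direction, which can be moved into the interior of the domain; this contradicts the existence of a
weak limit in that direction dominating the functional. -/
theorem subset_closedConvexHull_weakLimsupDir_add [CompleteSpace X] (hX : IsReflexiveSpace X)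
    {A : X → Set (StrongDual ℝ X)} (hA : IsMaximalMonotone A)
    (hint : (interior (dom A)).Nonempty) {D : Set X} (hDsub : D ⊆ dom A)
    (hDdense : dom A ⊆ closure D) {s : X → StrongDual ℝ X} (hs : IsSelection s A) (x : X) :
    A x ⊆ closedConvexHull ℝ (⋃ v ∈ {v : X | x + v ∈ interior (dom A)}, weakLimsupDir s D x v)
      + normalCone x (closure (dom A)) := by
  intro f hf
  set L := ⋃ v ∈ {v : X | x + v ∈ interior (dom A)}, weakLimsupDir s D x v with hL
  set N := normalCone x (closure (dom A)) with hN
  have hLA : closedConvexHull ℝ L ⊆ A x := by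
    refine closedConvexHull_min (iUnion₂_subset fun v _ => ?_) (hA.convex x) (hA.isClosed x)
    exact (weakLimsupDir_subset_weakLimsup s D x v).trans (weakLimsup_subset hA hDsub hs x)
  obtain ⟨a, ha⟩ := hint
  obtain ⟨v₀, rfl⟩ : ∃ v₀, a = x + v₀ := ⟨a - x, by abel⟩
  obtain ⟨ρ, M, K, hρ, hK, h⟩ := exists_hasAffineMinorants hX hA ha
  have hC : ∀ k ∈ A x, k v₀ + ρ * ‖k‖ ≤ M * ‖v₀‖ + K := by
    intro k hk
    have h1 := h.mul_norm_le hρ hk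
    rw [sub_add_cancel_left, map_neg, norm_neg] at h1
    linarith
  set C := M * ‖v₀‖ + K
  have hcl : IsClosed (closedConvexHull ℝ L + N) := isClosed_add_normalCone hX
    (subset_closure (interior_subset ha)) hρ hC hLA convex_closedConvexHull
    isClosed_closedConvexHull
  have hconv : Convex ℝ (closedConvexHull ℝ L + N) :=
    convex_closedConvexHull.add (convex_normalCone x _)
  by_contra hfn
  obtain ⟨Φ, c, hΦ, hc⟩ := geometric_hahn_banach_closed_point hconv hcl hfn
  obtain ⟨v, rfl⟩ := hX Φ
  simp only [NormedSpace.dual_def] at hΦ hc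
  have hsub : ∀ k ∈ closedConvexHull ℝ L, ∀ n ∈ N, k v + n v < c := fun k hk n hn => by
    simpa using hΦ _ (add_mem_add hk hn)
  have hzero : (0 : StrongDual ℝ X) ∈ N := fun y _ => by simp
  have hLsub : ∀ {d k}, x + d ∈ interior (dom A) → k ∈ weakLimsupDir s D x d →
      k ∈ closedConvexHull ℝ L := fun hd hk =>
    subset_closedConvexHull (mem_iUnion₂.2 ⟨_, hd, hk⟩)
  have hv : ∀ n ∈ N, n v ≤ 0 := by
    intro n hn
    obtain ⟨k, hk, -⟩ := exists_mem_weakLimsupDir_le hX hA hDsub hDdense hs hf ha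
    by_contra hpos
    push Not at hpos
    obtain ⟨m, hm⟩ := exists_nat_gt ((c - k v) / n v)
    rw [div_lt_iff₀ hpos] at hm
    have h1 := hsub k (hLsub ha hk) ((m : ℝ) • n) fun y hy =>
      mul_nonpos_of_nonneg_of_nonpos m.cast_nonneg (hn y hy)
    rw [smul_apply, smul_eq_mul] at h1
    linarith
  -- The gap `f v - c` absorbs the change caused by `ε • v₀`, since `k v₀ ≤ C` on `A x`.
  obtain ⟨ε, hε, hεC⟩ : ∃ ε : ℝ, 0 < ε ∧ ε * (C - f v₀) < f v - c := by
    have hpos : 0 < |C - f v₀| + 1 := by positivity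
    refine ⟨(f v - c) / (|C - f v₀| + 1), div_pos (by linarith) hpos, ?_⟩
    rw [div_mul_eq_mul_div, div_lt_iff₀ hpos]
    have := le_abs_self (C - f v₀)
    nlinarith
  obtain ⟨r, hr, hrint⟩ := exists_pos_add_smul_mem_interior_dom hX hA hv ha hε
  obtain ⟨k, hk, hfk⟩ := exists_mem_weakLimsupDir_le hX hA hDsub hDdense hs hf hrint
  have hkL := hLsub hrint hk
  have h1 := hsub k hkL 0 hzero
  have h2 := hC k (hLA hkL)
  have h3 : 0 ≤ ρ * ‖k‖ := by positivity
  simp only [map_smul, map_add, smul_eq_mul, zero_apply] at hfk h1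
  have h4 := le_of_mul_le_mul_left hfk hr
  have h5 : ε * k v₀ ≤ ε * C := mul_le_mul_of_nonneg_left (by linarith) hε.le
  linarith

end MonotoneOperator

theorem mainTheorem7 {X : Type*} [NormedAddCommGroup X] [NormedSpace ℝ X] [CompleteSpace X]
    (hX : MonotoneOperator.IsReflexiveSpace X)
    (A : X → Set (StrongDual ℝ X)) (hA : MonotoneOperator.IsMaximalMonotone A)
    (hint : (interior (MonotoneOperator.dom A)).Nonempty)
    (D : Set X) (hDsub : D ⊆ MonotoneOperator.dom A)
    (hDdense : MonotoneOperator.dom A ⊆ closure D)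
    (s : X → StrongDual ℝ X) (hs : MonotoneOperator.IsSelection s A) (x : X) :
    A x = closedConvexHull ℝ
          (⋃ v ∈ {v : X | x + v ∈ interior (MonotoneOperator.dom A)},
            MonotoneOperator.weakLimsupDir s D x v)
        + MonotoneOperator.normalCone x (closure (MonotoneOperator.dom A)) ∧
    A x = closedConvexHull ℝ (MonotoneOperator.weakLimsup s D x)
        + MonotoneOperator.normalCone x (closure (MonotoneOperator.dom A)) := by
  have hsub := MonotoneOperator.subset_closedConvexHull_weakLimsupDir_add hX hA hint hDsub
    hDdense hs x
  have hmono : closedConvexHull ℝ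
      (⋃ v ∈ {v : X | x + v ∈ interior (MonotoneOperator.dom A)},
        MonotoneOperator.weakLimsupDir s D x v) ⊆
      closedConvexHull ℝ (MonotoneOperator.weakLimsup s D x) :=
    (closedConvexHull ℝ).monotone (Set.iUnion₂_subset fun v _ =>
      MonotoneOperator.weakLimsupDir_subset_weakLimsup s D x v)
  have hsup : closedConvexHull ℝ (MonotoneOperator.weakLimsup s D x)
      + MonotoneOperator.normalCone x (closure (MonotoneOperator.dom A)) ⊆ A x := by
    rintro _ ⟨k, hk, n, hn, rfl⟩
    exact hA.add_mem (closedConvexHull_min (MonotoneOperator.weakLimsup_subset hA hDsub hs x)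
      (hA.convex x) (hA.isClosed x) hk) hn
  exact ⟨hsub.antisymm ((Set.add_subset_add_right hmono).trans hsup),
    (hsub.trans (Set.add_subset_add_right hmono)).antisymm hsup⟩
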